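/- Let $\mathcal X$ be a complex Banach space and let $T$ be a bounded linear operator on $\mathcal X$, with spectrum $\sigma(T)$. Suppose that $1$ is a simple pole of the resolvent $\lambda\mapsto (T-\lambda I)^{-1}$ (that is, the resolvent is defined on a punctured neighbourhood of $1$ and has a pole of order exactly one at $1$), and that $\sigma(T)\cap\mathbb T$ has arclength measure zero, where $\mathbb T=\{z\in\mathbb C:|z|=1\}$. Suppose further that $T-\lambda I$ is invertible for every $\lambda\in\mathbb C$ with $|\lambda|>1$ and that, for some integer $r\ge 1$, $$\sup_{\lambda\in\mathbb C,\ |\lambda|>1}\frac{(|\lambda|-1)^r}{|\lambda|^{r-1}}\,\|(T-\lambda I)^{-1}\|<\infty,\qquad \sup_{\lambda\in\mathbb R,\ \lambda>1}(\lambda-1)\,\|(T-\lambda I)^{-1}\|<\infty .$$ Define the Cesàro means of $T$ by $M_n^{(0)}(T)=T^n$ and, for $p\ge 1$ and $n\ge 0$, $$M_n^{(p)}(T)=\frac{p}{(n+1)\cdots(n+p)}\sum_{j=0}^n\frac{(j+p-1)!}{j!}\,M_j^{(p-1)}(T),$$ so that $M_0^{(p)}(T)=I$. Then $T$ has an ergodic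 projection $P_T$, that is, a bounded linear projection on $\mathcal X$ whose range is the kernel of $T-I$ and whose kernel is the closure of the range of $T-I$, and $$\|M_n^{(r)}(T)-P_T\|\to 0\qquad (n\to\infty).$$ -/

import Mathlib

open Filter Topology MeasureTheory
open scoped Nat

noncomputable section

variable {X : Type*} [NormedAddCommGroup X] [NormedSpace ℂ X]

/-- The Cesàro mean `M_n^{(p)}(T)` of order `p` of `T` (arguments in the order `T p n`):
`M_n^{(0)}(T) = T ^ n`, and for `p ≥ 1` the weighted mean
`p / ((n+1) ⋯ (n+p)) * ∑_{j ≤ n} (j+p-1)! / j! * M_j^{(p-1)}(T)`.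
For `n = 0` the formula gives `M_0^{(p)}(T) = I`. -/
def cesaroMean (T : X →L[ℂ] X) : ℕ → ℕ → (X →L[ℂ] X)
  | 0, n => T ^ n
  | p + 1, n =>
      (((p + 1 : ℕ) : ℂ) / ∏ k ∈ Finset.Icc 1 (p + 1), ((n : ℂ) + (k : ℂ))) •
        ∑ j ∈ Finset.range (n + 1),
          (((j + p)! : ℕ) / (j ! : ℕ) : ℂ) • cesaroMean T p j

/-- `P` is the ergodic projection of `T`: the bounded projection whose range is the kernel of
`T - I` and whose kernel is the closure of the range of `T - I`. -/
structure IsErgodicProjection (T P : X →L[ℂ] X) : Prop where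
  idem : P * P = P
  range_eq : Set.range P = {x : X | T x = x}
  ker_eq : {x : X | P x = 0} = closure (Set.range fun x : X => T x - x)

/-- `a` is a simple pole of the resolvent of `T`: the resolvent `z ↦ (z - T)⁻¹` exists on a
punctured neighbourhood of `a` and has a pole of order exactly one at `a`. -/
def IsSimplePoleOfResolvent (T : X →L[ℂ] X) (a : ℂ) : Prop :=
  (∀ᶠ z in 𝓝[≠] a, z ∈ resolventSet ℂ T) ∧
    meromorphicOrderAt (fun z : ℂ => resolvent T z) a = -1

/-- Arclength measure on the unit circle, as a measure on `ℂ`: the image of Lebesgue measure on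
`(0, 2π]` under `t ↦ exp (i t)`. -/
def arclengthMeasure : Measure ℂ :=
  Measure.map (fun t : ℝ => Complex.exp (t * Complex.I))
    (volume.restrict (Set.Ioc 0 (2 * Real.pi)))

end

/-!
Let `g z = (z - 1) (z - T)⁻¹`, which extends analytically to `z = 1`, and let `P = g 1` be the
residue. Multiplying the identities `(z - T) (z - T)⁻¹ = (z - T)⁻¹ (z - T) = 1` by `z - 1` and
letting `z → 1` shows that `P` is the ergodic projection
(`isErgodicProjection_of_eventually_smul_resolvent`).

Up to the factor `(n + r).choose r`, which is at least `(n + 1) ^ r / r !`, the difference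
`cesaroMean T r n - P` is the `r`-fold iterated partial sum of `T ^ n - P`
(`choose_smul_cesaroMean_sub`), hence the `n`-th Taylor coefficient at `0` of
`G z = (1 - z)⁻ʳ ((1 - z T)⁻¹ - (1 - z)⁻¹ P)`. This function is holomorphic in the open unit disc,
so Cauchy's formula on the circle of radius `(1 + 1 / (n + 1))⁻¹` bounds `‖cesaroMean T r n - P‖`
by a constant times the mean of `(n + 1)⁻ʳ ‖G‖` over that circle (`norm_cesaroMean_sub_le`).

These integrands are uniformly bounded (`exists_bound_deviationGenerating`): away from `z = 1` by
the growth condition on the resolvent, and near `z = 1` because `(1 - z T)⁻¹ - (1 - z)⁻¹ P` is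
bounded there, the pole being simple, while `(n + 1)⁻¹ ≤ |1 - w|` for `w = 1 / z`. They tend to `0`
at each boundary point outside the spectrum, where `G` has a finite limit, and so almost
everywhere. Dominated convergence finishes the proof.
-/

/-! ### The residue at a simple pole -/

section Residue

variable {X : Type*} [NormedAddCommGroup X] [NormedSpace ℂ X]

theorem IsSimplePoleOfResolvent.exists_analyticAt {T : X →L[ℂ] X} {a : ℂ}
    (h : IsSimplePoleOfResolvent T a) :
    ∃ g : ℂ → X →L[ℂ] X, AnalyticAt ℂ g a ∧ g a ≠ 0 ∧
      ∀ᶠ z in 𝓝[≠] a, z ∈ resolventSet ℂ T ∧ (z - a) • resolvent T z = g z := by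
  obtain ⟨hev, hord⟩ := h
  have hmer : MeromorphicAt (fun z : ℂ => resolvent T z) a := by
    by_contra hn
    rw [meromorphicOrderAt_of_not_meromorphicAt hn] at hord
    exact absurd hord (by decide)
  obtain ⟨g, hg, hga, hgz⟩ := (meromorphicOrderAt_eq_int_iff (n := -1) hmer).1 hord
  refine ⟨g, hg, hga, ?_⟩
  filter_upwards [hev, hgz, self_mem_nhdsWithin] with z hz1 hz2 hz3
  refine ⟨hz1, ?_⟩
  rw [hz2, zpow_neg_one, smul_inv_smul₀ (sub_ne_zero.2 hz3)]

theorem sub_apply_resolvent {T : X →L[ℂ] X} {z : ℂ} (hz : z ∈ resolventSet ℂ T) (x : X) :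
    z • resolvent T z x - T (resolvent T z x) = x := by
  have h : (algebraMap ℂ (X →L[ℂ] X) z - T) * resolvent T z = 1 :=
    Ring.mul_inverse_cancel _ hz
  simpa [Algebra.algebraMap_eq_smul_one] using DFunLike.congr_fun h x

theorem resolvent_apply_sub {T : X →L[ℂ] X} {z : ℂ} (hz : z ∈ resolventSet ℂ T) (x : X) :
    resolvent T z (z • x - T x) = x := by
  have h : resolvent T z * (algebraMap ℂ (X →L[ℂ] X) z - T) = 1 :=
    Ring.inverse_mul_cancel _ hz
  simpa [Algebra.algebraMap_eq_smul_one] using DFunLike.congr_fun h x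

/-- The residue at `1` of the resolvent is the ergodic projection: the identities
`(z - T) R(z) = R(z) (z - T) = 1`, multiplied by `z - 1`, are read off in the limit `z → 1`. -/
theorem isErgodicProjection_of_eventually_smul_resolvent {T : X →L[ℂ] X} {g : ℂ → X →L[ℂ] X}
    (hg : ContinuousAt g 1)
    (hev : ∀ᶠ z in 𝓝[≠] (1 : ℂ), z ∈ resolventSet ℂ T ∧ (z - 1) • resolvent T z = g z) :
    IsErgodicProjection T (g 1) := by
  have hlim : ∀ x, Tendsto (fun z => g z x) (𝓝[≠] 1) (𝓝 (g 1 x)) := fun x =>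
    (hg.clm_apply continuousAt_const).tendsto.mono_left nhdsWithin_le_nhds
  have hid : Tendsto (fun z : ℂ => z - 1) (𝓝[≠] 1) (𝓝 0) := by
    have : Tendsto (fun z : ℂ => z - 1) (𝓝 1) (𝓝 (1 - 1)) :=
      tendsto_id.sub_const 1
    simpa using this.mono_left nhdsWithin_le_nhds
  have hid' : Tendsto (fun z : ℂ => z) (𝓝[≠] 1) (𝓝 1) :=
    tendsto_id.mono_left nhdsWithin_le_nhds
  have hfix : ∀ x, T (g 1 x) = g 1 x := by
    intro x
    have h1 : Tendsto (fun z : ℂ => z • g z x - T (g z x)) (𝓝[≠] 1)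
        (𝓝 ((1 : ℂ) • g 1 x - T (g 1 x))) :=
      (hid'.smul (hlim x)).sub ((T.continuous.tendsto _).comp (hlim x))
    have h2 : Tendsto (fun z : ℂ => z • g z x - T (g z x)) (𝓝[≠] 1) (𝓝 ((0 : ℂ) • x)) := by
      refine (hid.smul_const x).congr' ?_
      filter_upwards [hev] with z ⟨hz, hgz⟩
      conv_lhs => rw [← sub_apply_resolvent hz x]
      simp [← hgz, smul_sub, smul_smul, mul_comm]
    have := tendsto_nhds_unique h1 h2
    rw [one_smul, zero_smul, sub_eq_zero] at this
    exact this.symm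
  have hproj : ∀ x, T x = x → g 1 x = x := by
    intro x hx
    refine tendsto_nhds_unique (hlim x) (tendsto_const_nhds.congr' ?_)
    filter_upwards [hev] with z ⟨hz, hgz⟩
    have := resolvent_apply_sub hz x
    rw [hx] at this
    rw [← hgz, smul_apply, ← map_smul, sub_smul, one_smul, this]
  have hker : ∀ x, g 1 (T x - x) = 0 := by
    intro x
    have h1 : Tendsto (fun z : ℂ => (z - 1) • g z x - (z - 1) • x) (𝓝[≠] 1)
        (𝓝 ((0 : ℂ) • g 1 x - (0 : ℂ) • x)) :=
      (hid.smul (hlim x)).sub (hid.smul_const x)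
    rw [zero_smul, zero_smul, sub_zero] at h1
    refine tendsto_nhds_unique (hlim _) (h1.congr' ?_)
    filter_upwards [hev] with z ⟨hz, hgz⟩
    have h := resolvent_apply_sub hz x
    rw [map_sub, map_smul] at h
    rw [← hgz]
    simp only [smul_apply, map_sub, ← smul_sub]
    congr 1
    nth_rw 2 [← h]
    rw [sub_smul, one_smul]
    abel
  refine ⟨ContinuousLinearMap.ext fun x => hproj _ (hfix x), ?_, ?_⟩
  · ext x
    exact ⟨by rintro ⟨y, rfl⟩; exact hfix y, fun hx => ⟨x, hproj x hx⟩⟩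
  · apply Set.Subset.antisymm
    · intro x hx
      -- `x = (1 - T) R(z) x + g z x`, where the last term tends to `g 1 x = 0`.
      have hlx : Tendsto (fun z => x - g z x) (𝓝[≠] 1) (𝓝 x) := by
        have := (tendsto_const_nhds (x := x)).sub (hlim x)
        rwa [show g 1 x = 0 from hx, sub_zero] at this
      refine mem_closure_of_tendsto hlx ?_
      filter_upwards [hev] with z ⟨hz, hgz⟩
      refine ⟨-resolvent T z x, ?_⟩
      have h := sub_apply_resolvent hz x
      have hgx : g z x = z • resolvent T z x - resolvent T z x := by
        rw [← hgz, smul_apply, sub_smul, one_smul]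
      simp only [map_neg, hgx]
      linear_combination (norm := abel) h
    · refine closure_minimal ?_ (isClosed_eq (g 1).continuous continuous_const)
      rintro _ ⟨x, rfl⟩
      exact hker x

end Residue

/-! ### Cesàro means as iterated partial sums -/

section Cesaro

/-- The sequence of partial sums `n ↦ ∑ j ≤ n, a j`, with the last term included. Iterated `p`
times on `n ↦ T ^ n` it gives the unnormalised Cesàro means of order `p`. -/
def partialSums {E : Type*} [AddCommMonoid E] (a : ℕ → E) (n : ℕ) : E :=
  ∑ j ∈ Finset.range (n + 1), a j

variable {X : Type*} [NormedAddCommGroup X] [NormedSpace ℂ X]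

theorem prod_Icc_natCast_add (n p : ℕ) :
    ∏ k ∈ Finset.Icc 1 p, ((n : ℂ) + (k : ℂ)) = (p ! : ℂ) * ((n + p).choose p : ℂ) := by
  rw [← Nat.cast_mul, ← Nat.ascFactorial_eq_factorial_mul_choose, Nat.ascFactorial_eq_prod_range,
    ← Finset.Ico_add_one_right_eq_Icc, Finset.prod_Ico_eq_prod_range]
  push_cast
  exact Finset.prod_congr (by simp) fun i _ => by ring

theorem choose_smul_cesaroMean_succ (T : X →L[ℂ] X) (p n : ℕ) :
    ((n + (p + 1)).choose (p + 1) : ℂ) • cesaroMean T (p + 1) n =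
      ∑ j ∈ Finset.range (n + 1), ((j + p).choose p : ℂ) • cesaroMean T p j := by
  rw [cesaroMean, prod_Icc_natCast_add, smul_smul, Finset.smul_sum]
  refine Finset.sum_congr rfl fun j _ => ?_
  rw [smul_smul]
  congr 1
  have h1 : ((n + (p + 1)).choose (p + 1) : ℂ) ≠ 0 :=
    Nat.cast_ne_zero.2 (Nat.choose_pos (by omega)).ne'
  have h2 : ((p ! : ℕ) : ℂ) ≠ 0 := Nat.cast_ne_zero.2 p.factorial_ne_zero
  have h3 : ((j ! : ℕ) : ℂ) ≠ 0 := Nat.cast_ne_zero.2 j.factorial_ne_zero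
  have h4 : ((p : ℂ) + 1) ≠ 0 := Nat.cast_add_one_ne_zero p
  have h5 : (((j + p)! : ℕ) : ℂ) = ((j + p).choose p : ℂ) * (j ! : ℂ) * (p ! : ℂ) := by
    rw [← Nat.add_choose_mul_factorial_mul_factorial j p]
    push_cast
    ring
  rw [h5, Nat.factorial_succ]
  push_cast
  field_simp

theorem choose_smul_cesaroMean_sub (T P : X →L[ℂ] X) (p n : ℕ) :
    ((n + p).choose p : ℂ) • (cesaroMean T p n - P) =
      partialSums^[p] (fun j => T ^ j - P) n := by
  induction p generalizing n with
  | zero => simp [cesaroMean]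
  | succ p ih =>
    rw [Function.iterate_succ_apply', partialSums, smul_sub, choose_smul_cesaroMean_succ]
    simp_rw [← ih, smul_sub, Finset.sum_sub_distrib, ← Finset.sum_smul]
    congr 2
    rw [← Nat.cast_sum, Nat.sum_range_add_choose, add_assoc]

end Cesaro

/-! ### Generating functions -/

section GeneratingFunction

variable {A : Type*} [NormedRing A] [NormedAlgebra ℂ A] [CompleteSpace A]

theorem summable_and_hasSum_partialSums {a : ℕ → A} {z : ℂ} {s : A} (hz : ‖z‖ < 1)
    (hsum : Summable fun n => ‖z ^ n • a n‖) (hs : HasSum (fun n => z ^ n • a n) s) :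
    (Summable fun n => ‖z ^ n • partialSums a n‖) ∧
      HasSum (fun n => z ^ n • partialSums a n) ((1 - z)⁻¹ • s) := by
  have hgeo : Summable fun n => ‖algebraMap ℂ A (z ^ n)‖ := by
    simp_rw [norm_algebraMap, norm_pow]
    exact (summable_geometric_of_lt_one (norm_nonneg z) hz).mul_right _
  have hgs : HasSum (fun n => algebraMap ℂ A (z ^ n)) (algebraMap ℂ A (1 - z)⁻¹) :=
    (hasSum_geometric_of_norm_lt_one hz).map (algebraMap ℂ A) (continuous_algebraMap ℂ A)
  have hterm : ∀ n, ∑ k ∈ Finset.range (n + 1), z ^ k • a k * algebraMap ℂ A (z ^ (n - k)) =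
      z ^ n • partialSums a n := by
    intro n
    rw [partialSums, Finset.smul_sum]
    refine Finset.sum_congr rfl fun k hk => ?_
    rw [← Algebra.commutes, ← Algebra.smul_def, smul_smul, ← pow_add,
      Nat.sub_add_cancel (Finset.mem_range_succ_iff.1 hk)]
  have h1 := summable_norm_sum_mul_range_of_summable_norm hsum hgeo
  have h2 := hasSum_sum_range_mul_of_summable_norm hsum hgeo
  simp_rw [hterm] at h1 h2
  rw [hs.tsum_eq, hgs.tsum_eq, ← Algebra.commutes, ← Algebra.smul_def] at h2
  exact ⟨h1, h2⟩

theorem hasSum_iterate_partialSums {a : ℕ → A} {z : ℂ} {s : A} (hz : ‖z‖ < 1)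
    (hsum : Summable fun n => ‖z ^ n • a n‖) (hs : HasSum (fun n => z ^ n • a n) s) (p : ℕ) :
    HasSum (fun n => z ^ n • partialSums^[p] a n) ((1 - z)⁻¹ ^ p • s) := by
  suffices (Summable fun n => ‖z ^ n • partialSums^[p] a n‖) ∧
      HasSum (fun n => z ^ n • partialSums^[p] a n) ((1 - z)⁻¹ ^ p • s) from this.2
  induction p with
  | zero => simpa using And.intro hsum hs
  | succ p ih =>
    rw [Function.iterate_succ_apply', pow_succ', mul_smul]
    exact summable_and_hasSum_partialSums hz ih.1 ih.2

theorem hasSum_smul_pow_sub {T P : A} {z : ℂ} (hz : ‖z‖ < 1) (hzT : ‖z • T‖ < 1) :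
    (Summable fun n => ‖z ^ n • (T ^ n - P)‖) ∧
      HasSum (fun n => z ^ n • (T ^ n - P)) (Ring.inverse (1 - z • T) - (1 - z)⁻¹ • P) := by
  have hT : Summable fun n => ‖(z • T) ^ n‖ := summable_norm_geometric_of_norm_lt_one hzT
  have hP : Summable fun n => ‖z ^ n • P‖ := by
    simp_rw [norm_smul, norm_pow]
    exact (summable_geometric_of_lt_one (norm_nonneg z) hz).mul_right _
  have hterm : ∀ n, z ^ n • (T ^ n - P) = (z • T) ^ n - z ^ n • P := fun n => by
    rw [smul_sub, smul_pow]
  simp_rw [hterm]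
  refine ⟨(hT.add hP).of_nonneg_of_le (fun _ => norm_nonneg _) fun _ => norm_sub_le _ _, ?_⟩
  refine HasSum.sub ?_ ((hasSum_geometric_of_norm_lt_one hz).smul_const P)
  rw [NormedRing.inverse_one_sub _ hzT]
  exact hT.of_norm.hasSum

end GeneratingFunction

/-- Cauchy's estimate in integrated form. -/
theorem norm_coeff_le_integral {E : Type*} [NormedAddCommGroup E] [NormedSpace ℂ E]
    [CompleteSpace E] {f : ℂ → E} {a : ℕ → E} {ρ : ℝ} (hρ : 0 < ρ)
    (hf : DifferentiableOn ℂ f (Metric.closedBall 0 ρ))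
    (ha : ∀ᶠ z in 𝓝 (0 : ℂ), HasSum (fun n => z ^ n • a n) (f z)) (n : ℕ) :
    ‖a n‖ ≤ ((2 * Real.pi)⁻¹ * ∫ θ in (0 : ℝ)..2 * Real.pi, ‖f (circleMap 0 ρ θ)‖) * ρ⁻¹ ^ n := by
  let p : FormalMultilinearSeries ℂ ℂ E := fun n =>
    ContinuousMultilinearMap.mkPiRing ℂ (Fin n) (a n)
  have hp : HasFPowerSeriesAt f p 0 := by
    rw [hasFPowerSeriesAt_iff]
    simpa [p, FormalMultilinearSeries.coeff] using ha
  lift ρ to NNReal using hρ.le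
  have hq := (hf.hasFPowerSeriesOnBall (NNReal.coe_pos.1 hρ)).hasFPowerSeriesAt
  have h := norm_cauchyPowerSeries_le f 0 ρ n
  rw [← hp.eq_formalMultilinearSeries hq] at h
  simpa [p] using h

/-! ### The generating function of the normalised deviations -/

section Deviation

variable {X : Type*} [NormedAddCommGroup X] [NormedSpace ℂ X]

/-- The generating function `(1 - z)⁻ʳ ((1 - z T)⁻¹ - (1 - z)⁻¹ P)` of the sequence
`n ↦ (n + r).choose r • (cesaroMean T r n - P)`. -/
noncomputable def deviationGenerating (T P : X →L[ℂ] X) (r : ℕ) (z : ℂ) : X →L[ℂ] X :=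
  (1 - z)⁻¹ ^ r • (Ring.inverse (1 - z • T) - (1 - z)⁻¹ • P)

theorem isUnit_one_sub_smul {T : X →L[ℂ] X} {z : ℂ}
    (hres : ∀ z : ℂ, 1 < ‖z‖ → z ∈ resolventSet ℂ T) (hz : ‖z‖ < 1) : IsUnit (1 - z • T) := by
  rcases eq_or_ne z 0 with rfl | h0
  · simp
  have h : IsUnit (algebraMap ℂ (X →L[ℂ] X) z⁻¹ - T) :=
    hres z⁻¹ (by rw [norm_inv]; exact (one_lt_inv₀ (norm_pos_iff.2 h0)).2 hz)
  have := h.smul (Units.mk0 z h0)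
  rwa [Units.smul_mk0, smul_sub, Algebra.algebraMap_eq_smul_one, smul_inv_smul₀ h0] at this

theorem deviationGenerating_inv (T P : X →L[ℂ] X) (r : ℕ) {w : ℂ} (hw : 1 < ‖w‖) :
    deviationGenerating T P r w⁻¹ =
      (w ^ (r + 1) * (w - 1)⁻¹ ^ r) • (resolvent T w - (w - 1)⁻¹ • P) := by
  have h0 : w ≠ 0 := norm_pos_iff.1 (one_pos.trans hw)
  have h1 : w - 1 ≠ 0 := sub_ne_zero.2 fun h => by simp [h] at hw
  have hinv : (1 - w⁻¹)⁻¹ = w * (w - 1)⁻¹ := by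
    rw [← mul_inv_cancel₀ h0]
    field_simp
  have hRinv : Ring.inverse (1 - w⁻¹ • T) = w • resolvent T w := by
    have h := spectrum.units_smul_resolvent_self (r := Units.mk0 w h0) (a := T)
    simp only [Units.val_mk0, Units.smul_def] at h
    rw [h]
    simp [resolvent]
  rw [deviationGenerating, hinv, hRinv, mul_smul, ← smul_sub, smul_smul]
  congr 1
  rw [mul_pow]
  ring

/-- The growth condition on the resolvent controls `deviationGenerating` near the unit circle up
to the factor `(1 - |z|)⁻ʳ`. Near `z = 1` this factor is used up by `(1 - z)⁻ʳ`, and the rest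
stays bounded because the pole has been removed. -/
theorem exists_bound_deviationGenerating {T P : X →L[ℂ] X} {r : ℕ}
    (hbound : ∃ C : ℝ, ∀ z : ℂ, 1 < ‖z‖ →
      (‖z‖ - 1) ^ r / ‖z‖ ^ (r - 1) * ‖resolvent T z‖ ≤ C)
    (hnear : ∃ δ > 0, ∃ K : ℝ, ∀ w : ℂ, w ≠ 1 → ‖w - 1‖ < δ →
      ‖resolvent T w - (w - 1)⁻¹ • P‖ ≤ K) :
    ∃ K : ℝ, ∀ w : ℂ, 1 < ‖w‖ → ‖w‖ ≤ 2 →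
      (‖w‖ - 1) ^ r * ‖deviationGenerating T P r w⁻¹‖ ≤ K := by
  obtain ⟨C, hC⟩ := hbound
  obtain ⟨δ, hδ, K, hK⟩ := hnear
  refine ⟨max (2 ^ (r + 1) * K) (2 ^ (r + 1) * (δ⁻¹ ^ r * (2 ^ (r - 1) * C + δ⁻¹ * ‖P‖))),
    fun w hw hw2 => ?_⟩
  have hs : 0 < ‖w‖ - 1 := sub_pos.2 hw
  have hs1 : (‖w‖ - 1) ^ r ≤ 1 := pow_le_one₀ hs.le (by linarith)
  have hsd : ‖w‖ - 1 ≤ ‖w - 1‖ := by simpa using norm_sub_norm_le w 1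
  have hd : 0 < ‖w - 1‖ := hs.trans_le hsd
  have hw1 : w ≠ 1 := fun h => by simp [h] at hw
  rw [deviationGenerating_inv T P r hw, norm_smul, norm_mul, norm_pow, norm_pow, norm_inv]
  have hpow : ‖w‖ ^ (r + 1) ≤ 2 ^ (r + 1) := pow_le_pow_left₀ (norm_nonneg w) hw2 _
  set H := resolvent T w - (w - 1)⁻¹ • P with hH
  have hrw : (‖w‖ - 1) ^ r * (‖w‖ ^ (r + 1) * ‖w - 1‖⁻¹ ^ r * ‖H‖) =
    ‖w‖ ^ (r + 1) * (((‖w‖ - 1) ^ r * ‖w - 1‖⁻¹ ^ r) * ‖H‖) := by ring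
  rw [hrw]
  rcases lt_or_ge ‖w - 1‖ δ with hlt | hge
  · refine le_max_of_le_left (mul_le_mul hpow ?_ (by positivity) (by positivity))
    have h1 : (‖w‖ - 1) ^ r * ‖w - 1‖⁻¹ ^ r ≤ 1 := by
      rw [← mul_pow]
      refine pow_le_one₀ (by positivity) ?_
      rw [← div_eq_mul_inv]
      exact div_le_one_of_le₀ hsd hd.le
    calc _ ≤ 1 * ‖H‖ := by gcongr
      _ ≤ K := by rw [one_mul]; exact hK w hw1 hlt
  · refine le_max_of_le_right (mul_le_mul hpow ?_ (by positivity) (by positivity))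
    have hinv : ‖w - 1‖⁻¹ ≤ δ⁻¹ := inv_anti₀ hδ hge
    have hR : (‖w‖ - 1) ^ r * ‖resolvent T w‖ ≤ 2 ^ (r - 1) * C := by
      have h0 : 0 < ‖w‖ ^ (r - 1) := pow_pos (one_pos.trans hw) _
      have hCw := hC w hw
      have hC0 : 0 ≤ C := le_trans (by positivity) hCw
      calc (‖w‖ - 1) ^ r * ‖resolvent T w‖
          = ‖w‖ ^ (r - 1) * ((‖w‖ - 1) ^ r / ‖w‖ ^ (r - 1) * ‖resolvent T w‖) := by
            field_simp
        _ ≤ ‖w‖ ^ (r - 1) * C := by gcongr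
        _ ≤ 2 ^ (r - 1) * C := by gcongr
    have hHle : ‖H‖ ≤ ‖resolvent T w‖ + ‖w - 1‖⁻¹ * ‖P‖ := by
      refine (norm_sub_le _ _).trans_eq ?_
      rw [norm_smul, norm_inv]
    calc (‖w‖ - 1) ^ r * ‖w - 1‖⁻¹ ^ r * ‖H‖
        = ‖w - 1‖⁻¹ ^ r * ((‖w‖ - 1) ^ r * ‖H‖) := by ring
      _ ≤ δ⁻¹ ^ r * (2 ^ (r - 1) * C + δ⁻¹ * ‖P‖) := by
        gcongr
        calc (‖w‖ - 1) ^ r * ‖H‖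
            ≤ (‖w‖ - 1) ^ r * (‖resolvent T w‖ + ‖w - 1‖⁻¹ * ‖P‖) := by gcongr
          _ = (‖w‖ - 1) ^ r * ‖resolvent T w‖ + (‖w‖ - 1) ^ r * (‖w - 1‖⁻¹ * ‖P‖) := mul_add ..
          _ ≤ 2 ^ (r - 1) * C + 1 * (δ⁻¹ * ‖P‖) := by gcongr
          _ = _ := by rw [one_mul]

variable [CompleteSpace X]

theorem differentiableOn_deviationGenerating {T : X →L[ℂ] X} (P : X →L[ℂ] X) (r : ℕ)
    (hres : ∀ z : ℂ, 1 < ‖z‖ → z ∈ resolventSet ℂ T) :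
    DifferentiableOn ℂ (deviationGenerating T P r) (Metric.ball 0 1) := by
  intro z hz
  rw [mem_ball_zero_iff] at hz
  have h1 : 1 - z ≠ 0 := sub_ne_zero.2 fun h => by simp [← h] at hz
  have h2 : DifferentiableAt ℂ (fun z : ℂ => (1 - z)⁻¹) z := by fun_prop (disch := exact h1)
  have h3 : DifferentiableAt ℂ (fun z : ℂ => 1 - z • T) z := by fun_prop
  have h4 : DifferentiableAt ℂ (Ring.inverse : (X →L[ℂ] X) → (X →L[ℂ] X)) (1 - z • T) :=
    differentiableAt_inverse (isUnit_one_sub_smul hres hz)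
  have h5 : DifferentiableAt ℂ (fun z : ℂ => Ring.inverse (1 - z • T)) z :=
    DifferentiableAt.fun_comp' z h4 h3
  have h6 : DifferentiableAt ℂ (fun z : ℂ => (1 - z)⁻¹ ^ r) z := h2.fun_pow r
  exact (h6.fun_smul (h5.fun_sub (h2.smul_const P))).differentiableWithinAt

theorem eventually_hasSum_deviationGenerating (T P : X →L[ℂ] X) (r : ℕ) :
    ∀ᶠ z in 𝓝 (0 : ℂ), HasSum
      (fun n => z ^ n • (((n + r).choose r : ℂ) • (cesaroMean T r n - P)))
      (deviationGenerating T P r z) := by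
  have h1 : ∀ᶠ z in 𝓝 (0 : ℂ), ‖z‖ < 1 :=
    continuous_norm.continuousAt.eventually_lt continuousAt_const (by simp)
  have h2 : ∀ᶠ z in 𝓝 (0 : ℂ), ‖z • T‖ < 1 :=
    ContinuousAt.eventually_lt (by fun_prop) continuousAt_const (by simp)
  filter_upwards [h1, h2] with z hz hzT
  simp_rw [choose_smul_cesaroMean_sub]
  obtain ⟨hs, hs'⟩ := hasSum_smul_pow_sub (P := P) hz hzT
  exact hasSum_iterate_partialSums hz hs hs' r

theorem tendsto_pow_mul_norm_deviationGenerating {T : X →L[ℂ] X} (P : X →L[ℂ] X) {r : ℕ}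
    (hr : 1 ≤ r) {w₀ : ℂ} (hnorm : ‖w₀‖ = 1) (hw₀ : w₀ ∈ resolventSet ℂ T) (hne : w₀ ≠ 1)
    {w : ℕ → ℂ} (hw : ∀ n, 1 < ‖w n‖) (hlim : Tendsto w atTop (𝓝 w₀)) :
    Tendsto (fun n => (‖w n‖ - 1) ^ r * ‖deviationGenerating T P r (w n)⁻¹‖) atTop (𝓝 0) := by
  have h1 : Tendsto (fun n => (‖w n‖ - 1) ^ r) atTop (𝓝 0) := by
    have := ((hlim.norm.sub_const 1).pow r)
    rwa [hnorm, sub_self, zero_pow (by omega)] at this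
  have hinv : ContinuousAt (fun w : ℂ => (w - 1)⁻¹) w₀ :=
    (continuousAt_id.sub continuousAt_const).inv₀ (sub_ne_zero.2 hne)
  have hR : ContinuousAt (resolvent T) w₀ :=
    (spectrum.hasDerivAt_resolvent_const_left hw₀).continuousAt
  have h2 : ContinuousAt (fun w : ℂ =>
      (w ^ (r + 1) * (w - 1)⁻¹ ^ r) • (resolvent T w - (w - 1)⁻¹ • P)) w₀ :=
    ((continuousAt_id.pow _).mul (hinv.pow r)).smul (hR.sub (hinv.smul continuousAt_const))
  have h3 := h1.mul (h2.tendsto.comp hlim).norm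
  rw [zero_mul] at h3
  refine h3.congr fun n => ?_
  rw [deviationGenerating_inv T P r (hw n)]
  rfl

end Deviation

/-! ### Coefficient estimate and dominated convergence -/

section Convergence

theorem ae_exp_notMem_of_arclengthMeasure_eq_zero {E : Set ℂ} (hE : arclengthMeasure E = 0) :
    ∀ᵐ θ : ℝ, θ ∈ Set.Ioc 0 (2 * Real.pi) → Complex.exp (θ * Complex.I) ∉ E := by
  rw [← ae_restrict_iff' measurableSet_Ioc, ae_iff]
  simp only [not_not]
  exact Measure.preimage_null_of_map_null
    (by fun_prop : Continuous fun θ : ℝ => Complex.exp (θ * Complex.I)).aemeasurable hE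

/-- Inversion sends the circle of radius `R` to that of radius `R⁻¹` and reverses its
orientation, so boundary points of the disc are parametrised by the spectral variable `1 / z`. -/
theorem integral_norm_circleMap_eq_integral_inv {E : Type*} [NormedAddCommGroup E] (f : ℂ → E)
    (R : ℝ) :
    ∫ θ in (0 : ℝ)..2 * Real.pi, ‖f (circleMap 0 R⁻¹ θ)‖ =
      ∫ θ in (0 : ℝ)..2 * Real.pi, ‖f (circleMap 0 R θ)⁻¹‖ := by
  have h := intervalIntegral.integral_comp_sub_left (a := 0) (b := 2 * Real.pi)
    (fun θ => ‖f (circleMap 0 R⁻¹ θ)‖) (2 * Real.pi)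
  rw [sub_self, sub_zero] at h
  rw [← h]
  refine intervalIntegral.integral_congr fun θ _ => ?_
  rw [circleMap_zero_inv, ← periodic_circleMap 0 R⁻¹ (-θ), neg_add_eq_sub]

variable {X : Type*} [NormedAddCommGroup X] [NormedSpace ℂ X] [CompleteSpace X]

theorem norm_cesaroMean_sub_le {T : X →L[ℂ] X} (P : X →L[ℂ] X) (r n : ℕ)
    (hres : ∀ z : ℂ, 1 < ‖z‖ → z ∈ resolventSet ℂ T) :
    ‖cesaroMean T r n - P‖ ≤ r ! * Real.exp 1 * (2 * Real.pi)⁻¹ *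
      ∫ θ in (0 : ℝ)..2 * Real.pi, ((n + 1 : ℝ)⁻¹ ^ r *
        ‖deviationGenerating T P r (circleMap 0 (1 + (n + 1 : ℝ)⁻¹) θ)⁻¹‖) := by
  set R : ℝ := 1 + (n + 1 : ℝ)⁻¹ with hR
  have hN : (0 : ℝ) < n + 1 := by positivity
  have hR1 : 1 < R := by rw [hR]; linarith [inv_pos.2 hN]
  have hR0 : 0 < R := one_pos.trans hR1
  have hdiff : DifferentiableOn ℂ (deviationGenerating T P r) (Metric.closedBall 0 R⁻¹) :=
    (differentiableOn_deviationGenerating P r hres).mono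
      (Metric.closedBall_subset_ball (inv_lt_one_of_one_lt₀ hR1))
  have h := norm_coeff_le_integral (inv_pos.2 hR0) hdiff
    (eventually_hasSum_deviationGenerating T P r) n
  rw [integral_norm_circleMap_eq_integral_inv, inv_inv, norm_smul, Complex.norm_natCast] at h
  rw [intervalIntegral.integral_const_mul]
  set J := ∫ θ in (0 : ℝ)..2 * Real.pi, ‖deviationGenerating T P r (circleMap 0 R θ)⁻¹‖
  have hJ : 0 ≤ J := intervalIntegral.integral_nonneg (by positivity) fun _ _ => norm_nonneg _
  have hpow : R ^ n ≤ Real.exp 1 := by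
    calc R ^ n ≤ Real.exp (n + 1 : ℝ)⁻¹ ^ n := by
          refine pow_le_pow_left₀ hR0.le ?_ n
          rw [hR, add_comm]
          exact Real.add_one_le_exp _
      _ = Real.exp (n * (n + 1 : ℝ)⁻¹) := (Real.exp_nat_mul _ _).symm
      _ ≤ Real.exp 1 := by
          rw [Real.exp_le_exp, ← div_eq_mul_inv, div_le_one hN]
          linarith
  have hchoose : (n + 1 : ℝ) ^ r ≤ r ! * ((n + r).choose r : ℝ) := by
    have := Nat.pow_succ_le_ascFactorial (n + 1) r
    rw [Nat.ascFactorial_eq_factorial_mul_choose] at this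
    exact_mod_cast this
  have key : (n + 1 : ℝ) ^ r * ‖cesaroMean T r n - P‖ ≤
      r ! * (((2 * Real.pi)⁻¹ * J) * Real.exp 1) := by
    calc (n + 1 : ℝ) ^ r * ‖cesaroMean T r n - P‖
        ≤ r ! * ((n + r).choose r : ℝ) * ‖cesaroMean T r n - P‖ := by gcongr
      _ = r ! * (((n + r).choose r : ℝ) * ‖cesaroMean T r n - P‖) := mul_assoc ..
      _ ≤ r ! * (((2 * Real.pi)⁻¹ * J) * R ^ n) := by gcongr
      _ ≤ _ := by gcongr
  calc ‖cesaroMean T r n - P‖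
      = (n + 1 : ℝ)⁻¹ ^ r * ((n + 1 : ℝ) ^ r * ‖cesaroMean T r n - P‖) := by
        rw [← mul_assoc, ← mul_pow, inv_mul_cancel₀ hN.ne', one_pow, one_mul]
    _ ≤ (n + 1 : ℝ)⁻¹ ^ r * (r ! * (((2 * Real.pi)⁻¹ * J) * Real.exp 1)) := by gcongr
    _ = _ := by ring

end Convergence

/-- `resolvent T z` is `(z - T)⁻¹`, which has the same norm as `(T - z)⁻¹`. Finiteness of the
supremum over `|z| > 1` includes that `(T - z)⁻¹` exists there, which is `hres`. -/
theorem corollary4p5 {X : Type*} [NormedAddCommGroup X] [NormedSpace ℂ X] [CompleteSpace X]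
    (T : X →L[ℂ] X) (r : ℕ) (hr : 1 ≤ r)
    (hpole : IsSimplePoleOfResolvent T 1)
    (hmeas : arclengthMeasure (spectrum ℂ T ∩ Metric.sphere (0 : ℂ) 1) = 0)
    (hres : ∀ z : ℂ, 1 < ‖z‖ → z ∈ resolventSet ℂ T)
    (hbound : ∃ C : ℝ, ∀ z : ℂ, 1 < ‖z‖ →
      (‖z‖ - 1) ^ r / ‖z‖ ^ (r - 1) * ‖resolvent T z‖ ≤ C)
    (habel : ∃ C : ℝ, ∀ x : ℝ, 1 < x → (x - 1) * ‖resolvent T (x : ℂ)‖ ≤ C) :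
    ∃ P : X →L[ℂ] X, IsErgodicProjection T P ∧
      Tendsto (fun n : ℕ => ‖cesaroMean T r n - P‖) atTop (𝓝 0) := by
  obtain ⟨g, hg, hg1, hev⟩ := hpole.exists_analyticAt
  refine ⟨g 1, isErgodicProjection_of_eventually_smul_resolvent hg.continuousAt hev, ?_⟩
  -- Near `1` the difference below is `(g w - g 1) / (w - 1)`, a difference quotient of `g`.
  have hnear : ∃ δ > 0, ∃ K : ℝ, ∀ w : ℂ, w ≠ 1 → ‖w - 1‖ < δ →
      ‖resolvent T w - (w - 1)⁻¹ • g 1‖ ≤ K := by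
    obtain ⟨K, hK⟩ := hg.differentiableAt.isBigO_sub.bound
    have := (hK.filter_mono nhdsWithin_le_nhds).and hev
    rw [eventually_nhdsWithin_iff, Metric.eventually_nhds_iff] at this
    obtain ⟨δ, hδ, h⟩ := this
    refine ⟨δ, hδ, K, fun w hw hwδ => ?_⟩
    obtain ⟨h1, -, h2⟩ := h (by rwa [dist_eq_norm]) hw
    have hne : w - 1 ≠ 0 := sub_ne_zero.2 hw
    rw [← inv_smul_smul₀ hne (resolvent T w), h2, ← smul_sub, norm_smul, norm_inv,
      inv_mul_le_iff₀ (norm_pos_iff.2 hne), mul_comm]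
    exact h1
  obtain ⟨K, hK⟩ := exists_bound_deviationGenerating hbound hnear
  -- If `1` were a regular point, then `g w = (w - 1) • resolvent T w` would vanish at `1`.
  have hspec : (1 : ℂ) ∈ spectrum ℂ T := by
    intro hmem
    have hc : ContinuousAt (fun w : ℂ => (w - 1) • resolvent T w) 1 :=
      (continuousAt_id.sub continuousAt_const).smul
        (spectrum.hasDerivAt_resolvent_const_left hmem).continuousAt
    have h1 := hc.tendsto.mono_left (nhdsWithin_le_nhds (s := {1}ᶜ))
    rw [sub_self, zero_smul] at h1
    refine hg1 (tendsto_nhds_unique (hg.continuousAt.tendsto.mono_left nhdsWithin_le_nhds)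
      (h1.congr' ?_))
    filter_upwards [hev] with w hw using hw.2
  have hinv : ∀ n : ℕ, (0 : ℝ) < (n + 1 : ℝ)⁻¹ := fun n => by positivity
  have hnorm : ∀ (n : ℕ) (θ : ℝ), ‖circleMap 0 (1 + (n + 1 : ℝ)⁻¹) θ‖ = 1 + (n + 1 : ℝ)⁻¹ :=
    fun n θ => by rw [norm_circleMap_zero, abs_of_pos (by linarith [hinv n])]
  have hgt : ∀ (n : ℕ) (θ : ℝ), 1 < ‖circleMap 0 (1 + (n + 1 : ℝ)⁻¹) θ‖ :=
    fun n θ => by rw [hnorm]; linarith [hinv n]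
  have hint : Tendsto (fun n : ℕ => ∫ θ in (0 : ℝ)..2 * Real.pi, ((n + 1 : ℝ)⁻¹ ^ r *
      ‖deviationGenerating T (g 1) r (circleMap 0 (1 + (n + 1 : ℝ)⁻¹) θ)⁻¹‖)) atTop
      (𝓝 (∫ _ in (0 : ℝ)..2 * Real.pi, (0 : ℝ))) := by
    refine intervalIntegral.tendsto_integral_filter_of_dominated_convergence (fun _ => K)
      (Eventually.of_forall fun n => ?_) (Eventually.of_forall fun n => ae_of_all _ fun θ _ => ?_)
      intervalIntegrable_const ?_
    · have hcont : Continuous fun θ =>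
          deviationGenerating T (g 1) r (circleMap 0 (1 + (n + 1 : ℝ)⁻¹) θ)⁻¹ := by
        refine (differentiableOn_deviationGenerating (g 1) r hres).continuousOn.comp_continuous
          ((continuous_circleMap _ _).inv₀ fun θ => ?_) fun θ => ?_
        · exact norm_pos_iff.1 (one_pos.trans (hgt n θ))
        · rw [mem_ball_zero_iff, norm_inv]
          exact inv_lt_one_of_one_lt₀ (hgt n θ)
      exact (continuous_const.mul hcont.norm).aestronglyMeasurable
    · have hle : ‖circleMap 0 (1 + (n + 1 : ℝ)⁻¹) θ‖ ≤ 2 := by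
        rw [hnorm]
        linarith [inv_le_one_of_one_le₀ (show (1 : ℝ) ≤ n + 1 by simp)]
      have h := hK _ (hgt n θ) hle
      rw [hnorm, add_sub_cancel_left] at h
      rwa [Real.norm_of_nonneg (by positivity)]
    · filter_upwards [ae_exp_notMem_of_arclengthMeasure_eq_zero hmeas] with θ hθ hmem
      rw [Set.uIoc_of_le (by positivity)] at hmem
      have hn1 : ‖Complex.exp (θ * Complex.I)‖ = 1 := Complex.norm_exp_ofReal_mul_I θ
      have hns : Complex.exp (θ * Complex.I) ∉ spectrum ℂ T := fun h =>
        hθ hmem ⟨h, mem_sphere_zero_iff_norm.2 hn1⟩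
      have hlim : Tendsto (fun n : ℕ => circleMap 0 (1 + (n + 1 : ℝ)⁻¹) θ) atTop
          (𝓝 (Complex.exp (θ * Complex.I))) := by
        have h1 : Tendsto (fun n : ℕ => 1 + (n + 1 : ℝ)⁻¹) atTop (𝓝 (1 + 0)) := by
          simpa only [one_div] using (tendsto_one_div_add_atTop_nhds_zero_nat (𝕜 := ℝ)).const_add 1
        have h2 := (((Complex.continuous_ofReal.tendsto _).comp h1).mul_const
          (Complex.exp (θ * Complex.I)))
        simpa [circleMap, Function.comp_def] using h2
      have h := tendsto_pow_mul_norm_deviationGenerating (g 1) hr hn1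
        (spectrum.notMem_iff.1 hns) (fun h => hns (h ▸ hspec)) (fun n => hgt n θ) hlim
      simpa only [hnorm, add_sub_cancel_left] using h
  rw [intervalIntegral.integral_zero] at hint
  refine squeeze_zero (fun _ => norm_nonneg _)
    (fun n => norm_cesaroMean_sub_le (g 1) r n hres) ?_
  simpa only [mul_zero] using hint.const_mul (r ! * Real.exp 1 * (2 * Real.pi)⁻¹)
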